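/- Let $\Gamma$ be a finite simple graph with vertex set $V(\Gamma)$ and let $$G(\Gamma)=\langle\, v\in V(\Gamma)\mid [u,v]=1 \text{ whenever } \{u,v\}\notin E(\Gamma)\,\rangle$$ be the right-angled Artin group of $\Gamma$ (with the convention that non-adjacent vertices commute). For $g\in G(\Gamma)$ let $|g|$ be the word length of $g$ with respect to $V(\Gamma)^{\pm1}$; a word is reduced if it is a shortest word representing its element. A decomposition $g=g_1\cdots g_m$ is geodesic if $|g|=|g_1|+\cdots+|g_m|$. The support $\operatorname{supp}(g)$ is the set of vertices $v$ such that $v$ or $v^{-1}$ appears in a reduced word representing $g$. The element $g$ is non-split if $\operatorname{supp}(g)$ spans a connected subgraph of $\Gamma$, and cyclically reduced if it has minimal word length in its conjugacy class. For a vertex $v_0$, an element is $v_0$-conical if $v_0$ is the only vertex $v$ such that $v$ or $v^{-1}$ is the first letter of some reduced word representing that element. Let $g\in G(\Gamma)$ be non-split and cyclically reduced, and let $v_0\in\operatorname{supp}(g)$. Then there exist a $v_0$-conical element $p\in G(\Gamma)$, elements $a,b\in G(\Gamma)$ and an integer $k$ with $0\le k\le |V(\Gamma)|-1$ such that $$g=apa^{-1}=b^{-1}pb,$$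 and $g^k=ab$ is a geodesic decomposition. Moreover, for these $p,a,b,k$ and for every integer $n\ge |V(\Gamma)|$, $g^n=a\,p^{n-k}\,b$ is a geodesic decomposition, also when $p^{n-k}$ is written as a product of $n-k$ factors $p$; that is, $|g^n|=|a|+|p^{n-k}|+|b|=|a|+(n-k)|p|+|b|$. -/

import Mathlib

namespace RAAG

/-- The defining relators of `G(Γ)`: the commutators `[u, v]` of pairs of vertices that are
*not* joined by an edge of `Γ` (the "opposite" convention for right-angled Artin groups). -/
def relators {V : Type*} (Γ : SimpleGraph V) : Set (FreeGroup V) :=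
  {r | ∃ u v : V, ¬ Γ.Adj u v ∧
    r = FreeGroup.of u * FreeGroup.of v * (FreeGroup.of u)⁻¹ * (FreeGroup.of v)⁻¹}

/-- The right-angled Artin group
`G(Γ) = ⟨ v ∈ V(Γ) ∣ [u, v] = 1 if {u, v} ∉ E(Γ) ⟩`. -/
abbrev Grp {V : Type*} (Γ : SimpleGraph V) : Type _ := PresentedGroup (relators Γ)

/-- The group element represented by a word. The letter `(v, true)` stands for the generator `v`
and the letter `(v, false)` for its inverse. -/
def eval {V : Type*} (Γ : SimpleGraph V) (w : List (V × Bool)) : Grp Γ :=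
  PresentedGroup.mk (relators Γ) (FreeGroup.mk w)

theorem exists_eval_eq {V : Type*} (Γ : SimpleGraph V) (g : Grp Γ) :
    ∃ w : List (V × Bool), eval Γ w = g := by
  classical
  obtain ⟨x, rfl⟩ := PresentedGroup.mk_surjective (relators Γ) g
  exact ⟨x.toWord, by rw [eval, FreeGroup.mk_toWord]⟩

/-- The word length `|g|`: the smallest length of a word representing `g`
(there is such a word by `exists_eval_eq`). -/
noncomputable def length {V : Type*} {Γ : SimpleGraph V} (g : Grp Γ) : ℕ :=
  sInf {n | ∃ w : List (V × Bool), eval Γ w = g ∧ w.length = n}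

/-- `w` is a reduced word representing `g`: a shortest one among all words representing `g`. -/
def IsReducedWordOf {V : Type*} {Γ : SimpleGraph V} (w : List (V × Bool)) (g : Grp Γ) : Prop :=
  eval Γ w = g ∧ ∀ w' : List (V × Bool), eval Γ w' = g → w.length ≤ w'.length

/-- The support of `g`: the vertices `v` such that `v` or `v⁻¹` appears in a reduced word
representing `g`. -/
def supp {V : Type*} {Γ : SimpleGraph V} (g : Grp Γ) : Set V :=
  {v | ∃ w : List (V × Bool), IsReducedWordOf w g ∧ ∃ ε : Bool, (v, ε) ∈ w}

/-- `g` is non-split if its support spans a connected subgraph of `Γ`. -/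
def IsNonSplit {V : Type*} {Γ : SimpleGraph V} (g : Grp Γ) : Prop :=
  (Γ.induce (supp g)).Connected

/-- `g` is cyclically reduced if it has minimal word length in its conjugacy class. -/
def IsCyclicallyReduced {V : Type*} {Γ : SimpleGraph V} (g : Grp Γ) : Prop :=
  ∀ h : Grp Γ, IsConj g h → length g ≤ length h

/-- The set `S(g)` of starting generators: the vertices `v` such that `v` or `v⁻¹` is the first
letter of a reduced word representing `g`. -/
def startingGenerators {V : Type*} {Γ : SimpleGraph V} (g : Grp Γ) : Set V :=
  {v | ∃ (ε : Bool) (w : List (V × Bool)), IsReducedWordOf ((v, ε) :: w) g}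

/-- `g` is `v₀`-conical if `S(g) = {v₀}`. -/
def IsConical {V : Type*} {Γ : SimpleGraph V} (v₀ : V) (g : Grp Γ) : Prop :=
  startingGenerators g = {v₀}

/-- `g = g₁ ⋯ gₘ` is a geodesic decomposition, where `l = [g₁, …, gₘ]`:
the product is `g` and `|g| = |g₁| + ⋯ + |gₘ|`. -/
def IsGeodesicDecomposition {V : Type*} {Γ : SimpleGraph V} (g : Grp Γ) (l : List (Grp Γ)) :
    Prop :=
  g = l.prod ∧ length g = (l.map length).sum

end RAAG

/-! Write a reduced word of `g` as `low` · `up`, where `up` holds the occurrences of `v₀` and the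
letters blocked behind them; `g` is conical when `low` is empty. Otherwise rotate to `up` · `low`.
Connectedness of the support gives an edge from a vertex of `low` to one occurring only in `up`, so
the vertex set of the new `low` shrinks strictly. It never contains `v₀`, so at most |V| - 1
rotations are needed (`exists_conjugate_words`). The rotations collect words for `a` and `b` of
total length k|g| with g^k = ab. Cyclic reducedness gives |g^n| = n|g| (`length_pow`), so every
triangle inequality involved is an equality. The combinatorics rests on `exists_cancel`, proved by
letting the group act on piles. -/

namespace RAAG

/-! ### Words and commutation. -/

section Words

variable {V : Type*} (Γ : SimpleGraph V)

theorem eval_nil : eval Γ [] = 1 := rfl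

theorem eval_append (w w' : List (V × Bool)) :
    eval Γ (w ++ w') = eval Γ w * eval Γ w' := by
  rw [eval, ← FreeGroup.mul_mk, map_mul]; rfl

theorem eval_cons (x : V × Bool) (w : List (V × Bool)) :
    eval Γ (x :: w) = eval Γ [x] * eval Γ w :=
  eval_append Γ [x] w

theorem eval_letter_mul_inv (x : V × Bool) :
    eval Γ [x] * eval Γ [(x.1, !x.2)] = 1 := by
  have h : eval Γ [(x.1, !x.2)] = (eval Γ [x])⁻¹ := by
    rw [eval, eval, ← map_inv, FreeGroup.inv_mk]; rfl
  rw [h, mul_inv_cancel]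

theorem commute_of {u v : V} (h : ¬ Γ.Adj u v) :
    Commute (eval Γ [(u, true)]) (eval Γ [(v, true)]) := by
  have h1 : PresentedGroup.mk (relators Γ)
      (FreeGroup.of u * FreeGroup.of v * (FreeGroup.of u)⁻¹ * (FreeGroup.of v)⁻¹) = 1 :=
    PresentedGroup.one_of_mem ⟨u, v, h, rfl⟩
  simp only [map_mul, map_inv] at h1
  rw [mul_inv_eq_one, mul_inv_eq_iff_eq_mul] at h1
  exact h1

theorem eval_letter (x : V × Bool) :
    eval Γ [x] = if x.2 then eval Γ [(x.1, true)] else (eval Γ [(x.1, true)])⁻¹ := by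
  obtain ⟨v, ε⟩ := x
  cases ε
  · exact eq_inv_of_mul_eq_one_right (eval_letter_mul_inv Γ (v, true))
  · rfl

theorem commute_letters {x y : V × Bool} (h : ¬ Γ.Adj x.1 y.1) :
    Commute (eval Γ [x]) (eval Γ [y]) := by
  have := commute_of Γ h
  rw [eval_letter Γ x, eval_letter Γ y]
  split_ifs <;> simp [this]

theorem commute_letter_word {x : V × Bool} {w : List (V × Bool)}
    (h : ∀ y ∈ w, ¬ Γ.Adj x.1 y.1) : Commute (eval Γ [x]) (eval Γ w) := by
  induction w with
  | nil => exact Commute.one_right _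
  | cons y w ih =>
    rw [eval_cons]
    exact (commute_letters Γ (h y (by simp))).mul_right (ih fun z hz => h z (by simp [hz]))

end Words

/-! ### Word length. -/

section Length

variable {V : Type*} {Γ : SimpleGraph V}

theorem exists_word (g : Grp Γ) : ∃ w, eval Γ w = g ∧ w.length = length g := by
  obtain ⟨w, hw⟩ := exists_eval_eq Γ g
  exact Nat.sInf_mem (s := {n | ∃ w : List (V × Bool), eval Γ w = g ∧ w.length = n})
    ⟨w.length, w, hw, rfl⟩

theorem length_eval_le (w : List (V × Bool)) : length (eval Γ w) ≤ w.length :=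
  Nat.sInf_le ⟨w, rfl, rfl⟩

theorem isReducedWordOf_iff {w : List (V × Bool)} {g : Grp Γ} :
    IsReducedWordOf w g ↔ eval Γ w = g ∧ w.length = length g := by
  constructor
  · rintro ⟨h, h'⟩
    obtain ⟨w', hw', hl⟩ := exists_word g
    refine ⟨h, le_antisymm (hl ▸ h' w' hw') ?_⟩
    rw [← h]; exact length_eval_le w
  · rintro ⟨h, h'⟩
    refine ⟨h, fun w' hw' => ?_⟩
    rw [h', ← hw']; exact length_eval_le w'

theorem length_mul_le (g h : Grp Γ) : length (g * h) ≤ length g + length h := by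
  obtain ⟨w, rfl, hw⟩ := exists_word g
  obtain ⟨w', rfl, hw'⟩ := exists_word h
  rw [← hw, ← hw', ← eval_append, ← List.length_append]
  exact length_eval_le _

theorem length_pow_le (g : Grp Γ) (n : ℕ) : length (g ^ n) ≤ n * length g := by
  induction n with
  | zero =>
    rw [pow_zero, ← eval_nil Γ]
    exact (length_eval_le _).trans (by simp)
  | succ n ih =>
    rw [pow_succ, add_mul, one_mul]
    exact (length_mul_le _ _).trans (by omega)

end Length

/-! ### The action on piles. -/

section Piles

open Classical in
/-- Put the letter `x` on a pile: a bead on the stack of its own vertex and a blank on the stack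
of every neighbour. -/
noncomputable def push {V : Type*} (Γ : SimpleGraph V) (x : V × Bool)
    (s : V → List (Option Bool)) : V → List (Option Bool) := fun w =>
  if w = x.1 then some x.2 :: s w else if Γ.Adj x.1 w then none :: s w else s w

open Classical in
/-- Remove the top of the stack of `v` and of the stacks of all neighbours of `v`. -/
noncomputable def pop {V : Type*} (Γ : SimpleGraph V) (v : V)
    (s : V → List (Option Bool)) : V → List (Option Bool) := fun w =>
  if w = v ∨ Γ.Adj v w then (s w).tail else s w

/-- The piles of words, letters being put without cancellation. -/
inductive IsPile {V : Type*} (Γ : SimpleGraph V) : (V → List (Option Bool)) → Prop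
  | empty : IsPile Γ (fun _ => [])
  | push (x : V × Bool) (s : V → List (Option Bool)) : IsPile Γ s →
      (s x.1).head? ≠ some (some !x.2) → IsPile Γ (push Γ x s)

open Classical in
/-- Multiplication of a pile by a letter on the left. -/
noncomputable def act {V : Type*} (Γ : SimpleGraph V) (x : V × Bool)
    (s : V → List (Option Bool)) : V → List (Option Bool) :=
  if (s x.1).head? = some (some !x.2) then pop Γ x.1 s else push Γ x s

variable {V : Type*} {Γ : SimpleGraph V}

theorem pop_push (x : V × Bool) (s : V → List (Option Bool)) :
    pop Γ x.1 (push Γ x s) = s := by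
  funext w
  by_cases h1 : w = x.1 <;> by_cases h2 : Γ.Adj x.1 w <;> simp [pop, push, h1, h2]

theorem push_self (x : V × Bool) (s : V → List (Option Bool)) :
    push Γ x s x.1 = some x.2 :: s x.1 := by simp [push]

theorem push_of_not_adj {x : V × Bool} {v : V} (hne : v ≠ x.1) (h : ¬ Γ.Adj x.1 v)
    (s : V → List (Option Bool)) : push Γ x s v = s v := by simp [push, hne, h]

theorem pop_of_not_adj {u v : V} (hne : v ≠ u) (h : ¬ Γ.Adj u v)
    (s : V → List (Option Bool)) : pop Γ u s v = s v := by simp [pop, hne, h]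

theorem push_comm {x y : V × Bool} (hne : x.1 ≠ y.1) (h : ¬ Γ.Adj x.1 y.1)
    (s : V → List (Option Bool)) : push Γ x (push Γ y s) = push Γ y (push Γ x s) := by
  have h' : ¬ Γ.Adj y.1 x.1 := fun h'' => h h''.symm
  funext w
  by_cases h1 : w = x.1
  · subst h1; simp [push, hne, h']
  · by_cases h2 : w = y.1
    · subst h2; simp [push, h1, h]
    · simp only [push, h1, h2, if_false]
      split_ifs <;> rfl

theorem pop_comm (u v : V) (s : V → List (Option Bool)) :
    pop Γ u (pop Γ v s) = pop Γ v (pop Γ u s) := by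
  funext w
  simp only [pop]
  split_ifs <;> rfl

/-- Letters pushed after a bead that is still on top are neither at `v` nor adjacent to it, so that
bead can be pushed last. The inequality on `s'` lets `act_act_inv` push the letter back without
cancelling. -/
theorem IsPile.exists_push {s : V → List (Option Bool)} (hs : IsPile Γ s) {v : V} {ε : Bool}
    (h : (s v).head? = some (some ε)) :
    ∃ s', IsPile Γ s' ∧ (s' v).head? ≠ some (some !ε) ∧ s = RAAG.push Γ (v, ε) s' := by
  induction hs with
  | empty => simp at h
  | push x s hs hx ih =>
    by_cases h1 : v = x.1
    · subst h1
      rw [push_self] at h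
      simp only [List.head?_cons, Option.some.injEq] at h
      subst h
      exact ⟨s, hs, hx, rfl⟩
    · by_cases h2 : Γ.Adj x.1 v
      · simp [RAAG.push, h1, h2] at h
      · rw [push_of_not_adj h1 h2] at h
        obtain ⟨s', hs', hne, rfl⟩ := ih h
        have h3 : ¬ Γ.Adj v x.1 := fun h' => h2 h'.symm
        refine ⟨RAAG.push Γ x s', .push x s' hs' ?_, ?_, ?_⟩
        · rwa [push_of_not_adj (x := (v, ε)) (Ne.symm h1) h3] at hx
        · rwa [push_of_not_adj h1 h2]
        · exact push_comm (Ne.symm h1) h2 s'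

theorem IsPile.act {s : V → List (Option Bool)} (hs : IsPile Γ s) (x : V × Bool) :
    IsPile Γ (act Γ x s) := by
  unfold RAAG.act
  split_ifs with h
  · obtain ⟨s', hs', -, rfl⟩ := hs.exists_push h
    rwa [pop_push (x.1, !x.2)]
  · exact .push x s hs h

theorem act_act_inv {s : V → List (Option Bool)} (hs : IsPile Γ s) (x : V × Bool) :
    act Γ (x.1, !x.2) (act Γ x s) = s := by
  by_cases h : (s x.1).head? = some (some !x.2)
  · obtain ⟨s', hs', hne, rfl⟩ := hs.exists_push h
    have h1 : RAAG.act Γ x (push Γ (x.1, !x.2) s') = s' := by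
      rw [RAAG.act, if_pos h, pop_push (x.1, !x.2)]
    rw [h1, RAAG.act, if_neg hne]
  · rw [RAAG.act.eq_def Γ x, if_neg h, RAAG.act, if_pos (by simp [push_self]), pop_push x]

theorem act_comm {s : V → List (Option Bool)} (hs : IsPile Γ s) {x y : V × Bool}
    (hne : x.1 ≠ y.1) (h : ¬ Γ.Adj x.1 y.1) :
    act Γ x (act Γ y s) = act Γ y (act Γ x s) := by
  have h' : ¬ Γ.Adj y.1 x.1 := fun h'' => h h''.symm
  have key : ∀ {x y : V × Bool}, x.1 ≠ y.1 → ¬ Γ.Adj x.1 y.1 → ¬ Γ.Adj y.1 x.1 →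
      (s x.1).head? = some (some !x.2) → pop Γ x.1 (push Γ y s) = push Γ y (pop Γ x.1 s) := by
    intro x y hne h h' hx
    obtain ⟨s', -, -, rfl⟩ := hs.exists_push hx
    rw [push_comm (y := (x.1, !x.2)) hne.symm h', pop_push (x.1, !x.2), pop_push (x.1, !x.2)]
  by_cases hx : (s x.1).head? = some (some !x.2) <;>
    by_cases hy : (s y.1).head? = some (some !y.2) <;>
    simp only [act, hx, hy, if_true, if_false, push_of_not_adj hne h', pop_of_not_adj hne h',
      push_of_not_adj hne.symm h, pop_of_not_adj hne.symm h]
  · exact pop_comm _ _ _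
  · exact key hne h h' hx
  · exact (key hne.symm h' h hy).symm
  · exact push_comm hne h s

/-- A generator as a permutation of the set of piles. -/
noncomputable def actPerm (Γ : SimpleGraph V) (v : V) :
    Equiv.Perm {s : V → List (Option Bool) // IsPile Γ s} where
  toFun s := ⟨act Γ (v, true) s.1, s.2.act _⟩
  invFun s := ⟨act Γ (v, false) s.1, s.2.act _⟩
  left_inv s := Subtype.ext (act_act_inv s.2 (v, true))
  right_inv s := Subtype.ext (act_act_inv s.2 (v, false))

/-- The action of `G(Γ)` on piles. -/
noncomputable def pileHom (Γ : SimpleGraph V) :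
    Grp Γ →* Equiv.Perm {s : V → List (Option Bool) // IsPile Γ s} :=
  PresentedGroup.toGroup (f := actPerm Γ) (by
    rintro r ⟨u, v, huv, rfl⟩
    simp only [map_mul, map_inv, FreeGroup.lift_apply_of]
    rw [mul_inv_eq_one, mul_inv_eq_iff_eq_mul]
    -- A vertex is not adjacent to itself, so the relators include the trivial [u, u], which
    -- `act_comm` excludes.
    by_cases h : u = v
    · rw [h]
    · ext s : 2
      exact act_comm s.2 (x := (u, true)) (y := (v, true)) h huv)

/-- The pile of a word. -/
noncomputable def pile (Γ : SimpleGraph V) (w : List (V × Bool)) : V → List (Option Bool) :=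
  w.foldr (act Γ) fun _ => []

theorem pileHom_eval (w : List (V × Bool)) :
    (pileHom Γ (eval Γ w) ⟨_, .empty⟩).1 = pile Γ w := by
  have h : ∀ x : V × Bool, ∀ s, (pileHom Γ (eval Γ [x]) s).1 = act Γ x s.1 := by
    intro x s
    have h1 : pileHom Γ (eval Γ [(x.1, true)]) = actPerm Γ x.1 :=
      PresentedGroup.toGroup.of _
    rw [eval_letter]
    obtain ⟨v, ε⟩ := x
    cases ε
    · rw [if_neg (by simp), map_inv, h1]; rfl
    · rw [if_pos rfl, h1]; rfl
  induction w with
  | nil => rw [eval_nil, map_one]; rfl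
  | cons x w ih => rw [eval_cons, map_mul, Equiv.Perm.mul_apply, h, ih]; rfl

theorem pile_eq_of_eval_eq {w w' : List (V × Bool)} (h : eval Γ w = eval Γ w') :
    pile Γ w = pile Γ w' := by
  rw [← pileHom_eval, h, pileHom_eval]

/-- The number of beads of a pile. -/
noncomputable def size [Fintype V] (s : V → List (Option Bool)) : ℕ :=
  ∑ v, (s v).countP Option.isSome

theorem size_push [Fintype V] (x : V × Bool) (s : V → List (Option Bool)) :
    size (push Γ x s) = size s + 1 := by
  classical
  have : ∀ v, (push Γ x s v).countP Option.isSome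
      = (s v).countP Option.isSome + if v = x.1 then 1 else 0 := by
    intro v
    simp only [push]
    split_ifs <;> simp
  simp [size, this, Finset.sum_add_distrib]

theorem size_pop_le [Fintype V] (v : V) (s : V → List (Option Bool)) :
    size (pop Γ v s) ≤ size s := by
  refine Finset.sum_le_sum fun w _ => ?_
  simp only [pop]
  split_ifs
  · exact (List.tail_sublist _).countP_le
  · exact le_rfl

theorem size_pile_le [Fintype V] (w : List (V × Bool)) : size (pile Γ w) ≤ w.length := by
  induction w with
  | nil => simp [pile, size]
  | cons x w ih =>
    change size (act Γ x (pile Γ w)) ≤ w.length + 1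
    unfold act
    split_ifs
    · exact (size_pop_le _ _).trans (by omega)
    · rw [size_push]; omega

/-- A bead count equal to the length rules out any pop, so a top bead comes from a letter of `w`,
and no letter to its left has touched the stack of `v`. -/
theorem exists_of_head?_pile [Fintype V] {w : List (V × Bool)} (hw : size (pile Γ w) = w.length)
    {v : V} {ε : Bool} (h : (pile Γ w v).head? = some (some ε)) :
    ∃ A C, w = A ++ (v, ε) :: C ∧ ∀ y ∈ A, ¬ Γ.Adj v y.1 ∧ y.1 ≠ v := by
  induction w with
  | nil => simp [pile] at h
  | cons x w ih =>
    have hle := size_pile_le (Γ := Γ) w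
    change size (act Γ x (pile Γ w)) = w.length + 1 at hw
    change (act Γ x (pile Γ w) v).head? = _ at h
    unfold act at hw h
    split_ifs at hw h
    · have := size_pop_le (Γ := Γ) x.1 (pile Γ w)
      omega
    · rw [size_push] at hw
      by_cases h1 : v = x.1
      · subst h1
        rw [push_self] at h
        simp only [List.head?_cons, Option.some.injEq] at h
        subst h
        exact ⟨[], w, rfl, by simp⟩
      · by_cases h2 : Γ.Adj x.1 v
        · simp [push, h1, h2] at h
        · rw [push_of_not_adj h1 h2] at h
          obtain ⟨A, C, rfl, hA⟩ := ih (by omega) h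
          refine ⟨x :: A, C, rfl, ?_⟩
          simp only [List.mem_cons, forall_eq_or_imp]
          exact ⟨⟨fun h' => h2 h'.symm, fun h' => h1 h'.symm⟩, hA⟩

end Piles

/-! ### Cancellation and shuffling in reduced words. -/

section Reduced

variable {V : Type*} {Γ : SimpleGraph V}

theorem length_lt_of_cancel {x : V × Bool} {w A C : List (V × Bool)}
    (hw : w = A ++ (x.1, !x.2) :: C) (hA : ∀ y ∈ A, ¬ Γ.Adj x.1 y.1) :
    length (eval Γ (x :: w)) < w.length := by
  have h : eval Γ (x :: w) = eval Γ (A ++ C) := by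
    rw [hw, eval_cons, eval_append, eval_cons Γ _ C, eval_append, ← mul_assoc,
      (commute_letter_word Γ hA).eq, mul_assoc, ← mul_assoc (eval Γ [x]), eval_letter_mul_inv,
      one_mul]
  have := length_eval_le (Γ := Γ) (A ++ C)
  rw [h, hw]
  simp at this ⊢
  omega

theorem length_eval_suffix {w w' : List (V × Bool)}
    (h : length (eval Γ (w ++ w')) = (w ++ w').length) : length (eval Γ w') = w'.length := by
  have h1 := length_mul_le (eval Γ w) (eval Γ w')
  have h2 := length_eval_le (Γ := Γ) w
  have h3 := length_eval_le (Γ := Γ) w'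
  rw [← eval_append, h, List.length_append] at h1
  omega

variable [Fintype V]

theorem size_pile_eq {w : List (V × Bool)} (h : length (eval Γ w) = w.length) :
    size (pile Γ w) = w.length := by
  induction w with
  | nil => simp [pile, size]
  | cons x w ih =>
    have hw := ih (length_eval_suffix (w := [x]) h)
    change size (act Γ x (pile Γ w)) = w.length + 1
    unfold act
    split_ifs with h1
    · obtain ⟨A, C, hAC, hA⟩ := exists_of_head?_pile hw h1
      have := length_lt_of_cancel hAC fun y hy => (hA y hy).1
      rw [h, List.length_cons] at this
      omega
    · rw [size_push, hw]

/-- The pile depends only on the group element, so its bead count bounds the length of every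
representing word from below. -/
theorem length_eval_of_size_pile {w : List (V × Bool)} (h : size (pile Γ w) = w.length) :
    length (eval Γ w) = w.length := by
  obtain ⟨w', hw', hl⟩ := exists_word (eval Γ w)
  have h1 := size_pile_le (Γ := Γ) w'
  have h2 := length_eval_le (Γ := Γ) w
  rw [pile_eq_of_eval_eq hw'] at h1
  omega

/-- If `w` is reduced and `x w` is not, then `w` contains a letter cancelling `x`. -/
theorem exists_cancel {x : V × Bool} {w : List (V × Bool)} (h : length (eval Γ w) = w.length)
    (hx : length (eval Γ (x :: w)) ≠ w.length + 1) :
    ∃ A C, w = A ++ (x.1, !x.2) :: C ∧ ∀ y ∈ A, ¬ Γ.Adj x.1 y.1 ∧ y.1 ≠ x.1 := by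
  have hw := size_pile_eq h
  by_cases h1 : (pile Γ w x.1).head? = some (some !x.2)
  · exact exists_of_head?_pile hw h1
  · refine absurd (length_eval_of_size_pile (w := x :: w) ?_) hx
    change size (act Γ x (pile Γ w)) = w.length + 1
    rw [act, if_neg h1, size_push, hw]

/-- A letter that starts one reduced word can be shuffled to the front of every other one. -/
theorem exists_shuffle {x : V × Bool} {w w' : List (V × Bool)} (h : eval Γ w = eval Γ (x :: w'))
    (hw : length (eval Γ w) = w.length) (hl : w.length = w'.length + 1) :
    ∃ A C, w = A ++ x :: C ∧ (∀ y ∈ A, ¬ Γ.Adj x.1 y.1) ∧ eval Γ (A ++ C) = eval Γ w' := by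
  have hi : eval Γ ((x.1, !x.2) :: w) = eval Γ w' := by
    have := eval_letter_mul_inv Γ (x.1, !x.2)
    simp only [Bool.not_not] at this
    rw [eval_cons, h, eval_cons Γ x, ← mul_assoc, this, one_mul]
  obtain ⟨A, C, hAC, hA⟩ := exists_cancel (x := (x.1, !x.2)) hw (by
    have := length_eval_le (Γ := Γ) w'
    rw [hi]; omega)
  simp only [Bool.not_not] at hAC
  refine ⟨A, C, hAC, fun y hy => (hA y hy).1, ?_⟩
  have h1 := commute_letter_word Γ (x := x) (w := A) fun y hy => (hA y hy).1
  rw [hAC, eval_append, eval_cons Γ x C, eval_cons Γ x w', ← mul_assoc, ← h1.eq, mul_assoc] at h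
  rw [eval_append]
  exact mul_left_cancel h

theorem mem_of_eval_eq {w w' : List (V × Bool)} (h : eval Γ w = eval Γ w')
    (hw : length (eval Γ w) = w.length) (hl : w.length = w'.length) {y : V × Bool}
    (hy : y ∈ w') : y ∈ w := by
  induction w' generalizing w with
  | nil => simp at hy
  | cons x w' ih =>
    obtain ⟨A, C, rfl, -, h'⟩ := exists_shuffle h hw hl
    simp only [List.length_append, List.length_cons] at hl
    rcases List.mem_cons.1 hy with rfl | hy
    · simp
    · have hlen : length (eval Γ w') = w'.length := by
        refine length_eval_suffix (w := [x]) ?_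
        rw [List.singleton_append, ← h, hw]
        simp; omega
      have := ih h' (by rw [h', hlen, List.length_append]; omega)
        (by rw [List.length_append]; omega) hy
      simp only [List.mem_append, List.mem_cons] at this ⊢
      tauto

theorem mem_supp_iff {w : List (V × Bool)} {g : Grp Γ} (hw : IsReducedWordOf w g) {v : V} :
    v ∈ supp g ↔ ∃ ε, (v, ε) ∈ w := by
  refine ⟨?_, fun ⟨ε, h⟩ => ⟨w, hw, ε, h⟩⟩
  rintro ⟨w', hw', ε, h⟩
  rw [isReducedWordOf_iff] at hw hw'
  exact ⟨ε, mem_of_eval_eq (hw.1.trans hw'.1.symm) (by rw [hw.1, hw.2])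
    (hw.2.trans hw'.2.symm) h⟩

end Reduced

/-! ### Powers of cyclically reduced elements. -/

section Powers

variable {V : Type*} {Γ : SimpleGraph V} [Fintype V]

/-- A new copy of `w` is prepended letter by letter from its right end. A letter cancelling `x`
cannot lie in `t`, as `w` is reduced, nor beyond the next occurrence of `x`, so it lies in the part
`r` of the next copy. -/
theorem length_append_pow {g : Grp Γ} (hcr : IsCyclicallyReduced g) {w : List (V × Bool)}
    (hw : eval Γ w = g) (hl : length g = w.length) {W : List (V × Bool)}
    (hW : length (eval Γ (w ++ W)) = (w ++ W).length) (t r : List (V × Bool)) (ht : w = r ++ t) :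
    length (eval Γ (t ++ (w ++ W))) = (t ++ (w ++ W)).length := by
  induction t generalizing r with
  | nil => exact hW
  | cons x t ih =>
    by_contra hne
    obtain ⟨A, C, hAC, hA⟩ := exists_cancel (ih (r ++ [x]) (by simp [ht])) hne
    have hxt : length (eval Γ (x :: t)) = t.length + 1 := by
      refine length_eval_suffix (w := r) ?_
      rw [← ht, hw, hl]
    have hsplit : (∃ D, t = A ++ (x.1, !x.2) :: D) ∨
        ∃ B, A = t ++ B ∧ w ++ W = B ++ (x.1, !x.2) :: C := by
      rcases List.append_eq_append_iff.1 hAC with ⟨B, hB, hC⟩ | ⟨B, hB, hC⟩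
      · exact .inr ⟨B, hB, hC⟩
      · cases B with
        | nil => exact .inr ⟨[], by simpa using hB.symm, by simpa using hC.symm⟩
        | cons z D =>
          rw [List.cons_append, List.cons.injEq] at hC
          exact .inl ⟨D, by rw [hB, hC.1]⟩
    rcases hsplit with ⟨D, hD⟩ | ⟨B, rfl, hB⟩
    · have := length_lt_of_cancel hD fun y hy => (hA y hy).1
      omega
    · have hxw : x ∈ w := by simp [ht]
      rcases List.append_eq_append_iff.1 hB with ⟨B', rfl, -⟩ | ⟨B', hB', hC'⟩
      · exact (hA x (by simp [hxw])).2 rfl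
      · cases B' with
        | nil =>
          rw [List.append_nil] at hB'
          subst hB'
          exact (hA x (by simp [hxw])).2 rfl
        | cons z D =>
          rw [List.cons_append, List.cons.injEq] at hC'
          obtain ⟨rfl, -⟩ := hC'
          have hww : r ++ x :: t = B ++ (x.1, !x.2) :: D := by rw [← ht, hB']
          have hr : ∃ E, r = B ++ (x.1, !x.2) :: E := by
            rcases List.append_eq_append_iff.1 hww with ⟨E, rfl, hE⟩ | ⟨E, rfl, hE⟩
            · cases E with
              | nil =>
                simp only [List.nil_append, List.cons.injEq] at hE
                have := congrArg Prod.snd hE.1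
                simp at this
              | cons z E =>
                rw [List.cons_append, List.cons.injEq] at hE
                exact absurd rfl (hA x (by simp [← hE.1])).2
            · cases E with
              | nil =>
                simp only [List.nil_append, List.cons.injEq] at hE
                have := congrArg Prod.snd hE.1
                simp at this
              | cons z E =>
                rw [List.cons_append, List.cons.injEq] at hE
                exact ⟨E, by rw [hE.1]⟩
          obtain ⟨E, rfl⟩ := hr
          have hcB := commute_letter_word Γ (x := x) (w := B)
            fun y hy => (hA y (by simp [hy])).1
          have hct := commute_letter_word Γ (x := x) (w := t)
            fun y hy => (hA y (by simp [hy])).1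
          -- Here w = B x⁻¹ E x t with `x` commuting with `B` and `t`; conjugating by `x` deletes
          -- both letters, against minimality.
          have hconj : IsConj g (eval Γ (B ++ E ++ t)) := by
            rw [isConj_iff]
            refine ⟨eval Γ [x], ?_⟩
            have hi := eq_inv_of_mul_eq_one_right (eval_letter_mul_inv Γ x)
            rw [← hw, ht]
            simp only [eval_append, eval_cons Γ x t, eval_cons Γ (x.1, !x.2) E, hi]
            rw [hct.eq]
            calc _ = (eval Γ [x] * eval Γ B) * (eval Γ [x])⁻¹ * eval Γ E * eval Γ t := by group
              _ = _ := by rw [hcB.eq]; group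
          have h1 := hcr _ hconj
          have h2 := length_eval_le (Γ := Γ) (B ++ E ++ t)
          rw [hl, ht] at h1
          simp at h1 h2
          omega

theorem length_pow {g : Grp Γ} (hcr : IsCyclicallyReduced g) (n : ℕ) :
    length (g ^ n) = n * length g := by
  obtain ⟨w, hw, hl⟩ := exists_word g
  have key : ∀ n, ∃ W, eval Γ W = g ^ n ∧ W.length = n * length g ∧
      length (eval Γ (w ++ W)) = (w ++ W).length := by
    intro n
    induction n with
    | zero => exact ⟨[], by simp [eval_nil], by simp, by simp [hw, hl]⟩
    | succ n ih =>
      obtain ⟨W, hW, hWl, h⟩ := ih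
      refine ⟨w ++ W, by rw [eval_append, hw, hW, pow_succ'], ?_,
        length_append_pow hcr hw hl.symm h w [] rfl⟩
      rw [List.length_append, hl, hWl]; ring
  obtain ⟨W, hW, hWl, h⟩ := key n
  rw [← hW, length_eval_suffix h, hWl]

end Powers

/-! ### Rotating towards a conical element. -/

section Splitting

open Classical in
/-- The letters of `w` that do not lie above an occurrence of `v₀` or a neighbour of `S`. -/
noncomputable def low {V : Type*} (Γ : SimpleGraph V) (v₀ : V) :
    Set V → List (V × Bool) → List (V × Bool)
  | _, [] => []
  | S, x :: w => if x.1 = v₀ ∨ ∃ s ∈ S, Γ.Adj s x.1 then low Γ v₀ (insert x.1 S) w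
    else x :: low Γ v₀ S w

open Classical in
/-- The letters of `w` that lie above an occurrence of `v₀` or a neighbour of `S`. -/
noncomputable def up {V : Type*} (Γ : SimpleGraph V) (v₀ : V) :
    Set V → List (V × Bool) → List (V × Bool)
  | _, [] => []
  | S, x :: w => if x.1 = v₀ ∨ ∃ s ∈ S, Γ.Adj s x.1 then x :: up Γ v₀ (insert x.1 S) w
    else up Γ v₀ S w

variable {V : Type*} {Γ : SimpleGraph V} {v₀ : V}

theorem low_append_up_perm (S : Set V) (w : List (V × Bool)) :
    (low Γ v₀ S w ++ up Γ v₀ S w).Perm w := by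
  induction w generalizing S with
  | nil => exact .nil
  | cons x w ih =>
    unfold low up
    split_ifs
    · exact List.perm_middle.trans ((ih _).cons x)
    · exact (ih _).cons x

theorem of_mem_low {S : Set V} {w : List (V × Bool)} {y : V × Bool} (hy : y ∈ low Γ v₀ S w) :
    y.1 ≠ v₀ ∧ ∀ s ∈ S, ¬ Γ.Adj s y.1 := by
  induction w generalizing S with
  | nil => simp [low] at hy
  | cons x w ih =>
    unfold low at hy
    split_ifs at hy with h
    · exact ⟨(ih hy).1, fun s hs => (ih hy).2 s (by simp [hs])⟩
    · rcases List.mem_cons.1 hy with rfl | hy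
      · push Not at h; exact h
      · exact ih hy

/-- A letter sent to `up` enters `S`, so it commutes with all later letters of `low`. -/
theorem eval_low_mul_up (S : Set V) (w : List (V × Bool)) :
    eval Γ (low Γ v₀ S w) * eval Γ (up Γ v₀ S w) = eval Γ w := by
  induction w generalizing S with
  | nil => simp [low, up, eval_nil]
  | cons x w ih =>
    unfold low up
    split_ifs with h
    · have := commute_letter_word Γ (x := x) (w := low Γ v₀ (insert x.1 S) w)
        fun y hy => (of_mem_low hy).2 _ (by simp)
      rw [eval_cons Γ x, ← mul_assoc, ← this.eq, mul_assoc, ih, ← eval_cons]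
    · rw [eval_cons, mul_assoc, ih, ← eval_cons]

theorem low_up (S : Set V) (w : List (V × Bool)) : low Γ v₀ S (up Γ v₀ S w) = [] := by
  induction w generalizing S with
  | nil => rfl
  | cons x w ih =>
    rw [up]
    split_ifs with h
    · rw [low, if_pos h, ih]
    · exact ih S

theorem of_mem_low_append {S : Set V} {u w : List (V × Bool)} (hu : low Γ v₀ S u = [])
    {y : V × Bool} (hy : y ∈ low Γ v₀ S (u ++ w)) : y ∈ w ∧ ∀ z ∈ u, ¬ Γ.Adj z.1 y.1 := by
  induction u generalizing S with
  | nil => exact ⟨(low_append_up_perm S w).subset (List.mem_append_left _ hy), by simp⟩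
  | cons x u ih =>
    rw [low] at hu
    rw [List.cons_append, low] at hy
    split_ifs at hu hy with h
    refine ⟨(ih hu hy).1, ?_⟩
    simp only [List.mem_cons, forall_eq_or_imp]
    exact ⟨(of_mem_low hy).2 _ (by simp), (ih hu hy).2⟩

theorem adj_of_low_eq_nil {S : Set V} {A C : List (V × Bool)} {x : V × Bool}
    (h : low Γ v₀ S (A ++ x :: C) = []) :
    x.1 = v₀ ∨ (∃ s ∈ S, Γ.Adj s x.1) ∨ ∃ y ∈ A, Γ.Adj y.1 x.1 := by
  induction A generalizing S with
  | nil =>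
    rw [List.nil_append, low] at h
    split_ifs at h with h'
    exact h'.imp_right .inl
  | cons y A ih =>
    rw [List.cons_append, low] at h
    split_ifs at h
    rcases ih h with h | ⟨s, hs, h⟩ | ⟨z, hz, h⟩
    · exact .inl h
    · rcases hs with rfl | hs
      · exact .inr (.inr ⟨y, by simp, h⟩)
      · exact .inr (.inl ⟨s, hs, h⟩)
    · exact .inr (.inr ⟨z, by simp [hz], h⟩)

/-- The vertices occurring in a word. -/
def labels (w : List (V × Bool)) : Set V := {v | ∃ y ∈ w, y.1 = v}

/-- Each round uses (low · up)^(k+1) = low · (up · low)^k · up: `a` grows on the right of `low`, `b`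
on the left of `up`, and one more |w| is added to the total length. -/
theorem exists_conjugate_words {L : Set V} (hv₀ : v₀ ∈ L)
    (hL : ∀ X : Set V, X ⊆ L → X.Nonempty → X ≠ L → ∃ c ∈ X, ∃ d ∈ L \ X, Γ.Adj d c)
    [Finite V] (m : ℕ) (w : List (V × Bool)) (hw : labels w = L)
    (hm : (labels (low Γ v₀ ∅ w)).ncard ≤ m) :
    ∃ (p a b : List (V × Bool)) (k : ℕ), k ≤ m ∧ low Γ v₀ ∅ p = [] ∧ p.length = w.length ∧
      a.length + b.length = k * w.length ∧
      eval Γ w * eval Γ a = eval Γ a * eval Γ p ∧ eval Γ w ^ k = eval Γ a * eval Γ b := by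
  by_cases h0 : low Γ v₀ ∅ w = []
  · exact ⟨w, [], [], 0, by simp, h0, rfl, by simp, by simp [eval_nil], by simp [eval_nil]⟩
  have hsub : labels (low Γ v₀ ∅ w) ⊆ L := by
    rintro v ⟨y, hy, rfl⟩
    rw [← hw]
    exact ⟨y, (low_append_up_perm ∅ w).subset (List.mem_append_left _ hy), rfl⟩
  obtain ⟨c, hc, d, ⟨hdL, hd⟩, hdc⟩ := hL _ hsub
    (by obtain ⟨y, hy⟩ := List.exists_mem_of_ne_nil _ h0; exact ⟨y.1, y, hy, rfl⟩)
    (by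
      intro h
      rw [← h] at hv₀
      obtain ⟨y, hy, hyv⟩ := hv₀
      exact (of_mem_low hy).1 hyv)
  have hdu : ∃ z ∈ up Γ v₀ ∅ w, z.1 = d := by
    rw [← hw] at hdL
    obtain ⟨z, hz, rfl⟩ := hdL
    rcases List.mem_append.1 ((low_append_up_perm (Γ := Γ) (v₀ := v₀) ∅ w).symm.subset hz)
      with h | h
    · exact absurd ⟨z, h, rfl⟩ hd
    · exact ⟨z, h, rfl⟩
  have hperm : (up Γ v₀ ∅ w ++ low Γ v₀ ∅ w).Perm w :=
    List.perm_append_comm.trans (low_append_up_perm ∅ w)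
  -- All of `up` stays in `up`, and its letter at `d` now precedes and blocks every letter at `c`.
  have hlt : (labels (low Γ v₀ ∅ (up Γ v₀ ∅ w ++ low Γ v₀ ∅ w))).ncard
      < (labels (low Γ v₀ ∅ w)).ncard := by
    refine Set.ncard_lt_ncard ((Set.ssubset_iff_of_subset ?_).2 ⟨c, hc, ?_⟩) (Set.toFinite _)
    · rintro v ⟨y, hy, rfl⟩
      exact ⟨y, (of_mem_low_append (low_up _ _) hy).1, rfl⟩
    · rintro ⟨y, hy, rfl⟩
      obtain ⟨z, hz, rfl⟩ := hdu
      exact (of_mem_low_append (low_up _ _) hy).2 z hz hdc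
  cases m with
  | zero => omega
  | succ m =>
    obtain ⟨p, a, b, k, hk, hp, hpl, hab, hc, hg⟩ := exists_conjugate_words hv₀ hL m
      (up Γ v₀ ∅ w ++ low Γ v₀ ∅ w) (by
        rw [← hw]; ext v
        exact exists_congr fun y => and_congr_left fun _ => hperm.mem_iff) (by omega)
    have hlen := hperm.length_eq
    refine ⟨p, low Γ v₀ ∅ w ++ a, b ++ up Γ v₀ ∅ w, k + 1, by omega, hp, hpl.trans hlen, ?_, ?_, ?_⟩
    · rw [hlen] at hab
      simp only [List.length_append] at hlen ⊢
      rw [add_mul]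
      omega
    · rw [← eval_low_mul_up (v₀ := v₀) ∅ w, eval_append, mul_assoc, mul_assoc, ← hc,
        eval_append]
      group
    · rw [eval_append] at hg
      rw [← eval_low_mul_up (v₀ := v₀) ∅ w, eval_append, eval_append, pow_succ, ← mul_assoc,
        mul_pow_mul, hg]
      group

/-- A starting letter can be shuffled to the front of `p`, but a letter off `v₀` has an adjacent
letter before it. -/
theorem isConical_of_low_eq_nil [Fintype V] {p : List (V × Bool)} (hp : low Γ v₀ ∅ p = [])
    (hl : length (eval Γ p) = p.length) (hne : p ≠ []) : IsConical v₀ (eval Γ p) := by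
  have hfirst : ∀ v ∈ startingGenerators (eval Γ p), v = v₀ := by
    rintro v ⟨ε, w, hw⟩
    rw [isReducedWordOf_iff] at hw
    obtain ⟨A, C, rfl, hA, -⟩ := exists_shuffle hw.1.symm hl
      (by rw [← hl, ← hw.2, List.length_cons])
    rcases adj_of_low_eq_nil hp with h | ⟨s, hs, -⟩ | ⟨y, hy, h⟩
    · exact h
    · exact absurd hs (Set.notMem_empty s)
    · exact absurd h.symm (hA y hy)
  refine Set.eq_singleton_iff_unique_mem.2 ⟨?_, hfirst⟩
  obtain ⟨x, q, rfl⟩ := List.exists_cons_of_ne_nil hne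
  have hx : x.1 ∈ startingGenerators (eval Γ (x :: q)) :=
    ⟨x.2, q, isReducedWordOf_iff.2 ⟨rfl, hl.symm⟩⟩
  rwa [hfirst _ hx] at hx

end Splitting

/-- A set of vertices spanning a connected subgraph has an edge leaving every proper nonempty
subset. -/
theorem exists_adj_of_connected_induce {V : Type*} {Γ : SimpleGraph V} {L : Set V}
    (h : (Γ.induce L).Connected) {X : Set V} (hXL : X ⊆ L) (hX : X.Nonempty) (hne : X ≠ L) :
    ∃ c ∈ X, ∃ d ∈ L \ X, Γ.Adj d c := by
  obtain ⟨c, hc⟩ := hX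
  obtain ⟨d, hd, hdX⟩ := Set.exists_of_ssubset (hXL.ssubset_of_ne hne)
  obtain ⟨W⟩ := h.preconnected ⟨c, hXL hc⟩ ⟨d, hd⟩
  obtain ⟨e, -, h1, h2⟩ := W.exists_boundary_dart (Subtype.val ⁻¹' X) hc hdX
  exact ⟨_, h1, _, ⟨e.snd.2, h2⟩, e.adj.symm⟩

end RAAG

/-! ### Assembly. -/

theorem mainTheorem5 {V : Type*} [Fintype V] (Γ : SimpleGraph V) (g : RAAG.Grp Γ)
    (hns : RAAG.IsNonSplit g) (hcr : RAAG.IsCyclicallyReduced g)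
    (v₀ : V) (hv₀ : v₀ ∈ RAAG.supp g) :
    ∃ (p a b : RAAG.Grp Γ) (k : ℕ),
      RAAG.IsConical v₀ p ∧
      g = a * p * a⁻¹ ∧
      g = b⁻¹ * p * b ∧
      k ≤ Fintype.card V - 1 ∧
      RAAG.IsGeodesicDecomposition (g ^ k) [a, b] ∧
      ∀ n : ℕ, Fintype.card V ≤ n →
        RAAG.IsGeodesicDecomposition (g ^ n) [a, p ^ (n - k), b] ∧
        RAAG.IsGeodesicDecomposition (g ^ n) ([a] ++ List.replicate (n - k) p ++ [b]) := by
  obtain ⟨w, hw, ε, hmem⟩ := id hv₀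
  have hsupp : RAAG.labels w = RAAG.supp g := by
    ext v
    rw [RAAG.mem_supp_iff hw]
    exact ⟨fun ⟨y, hy, h⟩ => ⟨y.2, h ▸ hy⟩, fun ⟨δ, h⟩ => ⟨_, h, rfl⟩⟩
  obtain ⟨rfl, hl⟩ := RAAG.isReducedWordOf_iff.1 hw
  have hcard : (RAAG.labels (RAAG.low Γ v₀ ∅ w)).ncard ≤ Fintype.card V - 1 := by
    have : RAAG.labels (RAAG.low Γ v₀ ∅ w) ⊂ Set.univ := by
      refine Set.ssubset_univ_iff.2 fun h => ?_
      obtain ⟨y, hy, hyv⟩ : v₀ ∈ RAAG.labels (RAAG.low Γ v₀ ∅ w) := h ▸ Set.mem_univ _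
      exact (RAAG.of_mem_low hy).1 hyv
    have := Set.ncard_lt_ncard this (Set.toFinite _)
    rw [Set.ncard_univ, Nat.card_eq_fintype_card] at this
    omega
  obtain ⟨p, a, b, k, hk, hp, hpl, hab, hga, hgk⟩ := RAAG.exists_conjugate_words hv₀
    (fun X => RAAG.exists_adj_of_connected_induce hns) _ w hsupp hcard
  have hg : RAAG.eval Γ w = RAAG.eval Γ a * RAAG.eval Γ p * (RAAG.eval Γ a)⁻¹ := by
    rw [← hga, mul_inv_cancel_right]
  -- Since g commutes with g^k = ab and ga = ap, one gets abg = gab = apb; cancel `a`.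
  have hgb : RAAG.eval Γ w = (RAAG.eval Γ b)⁻¹ * RAAG.eval Γ p * RAAG.eval Γ b := by
    rw [mul_assoc, eq_inv_mul_iff_mul_eq]
    refine mul_left_cancel (a := RAAG.eval Γ a) ?_
    rw [← mul_assoc, ← hgk, ← pow_succ, pow_succ', hgk, ← mul_assoc, hga, mul_assoc]
  -- The word `p` is as long as `w` and represents a conjugate of the cyclically reduced g, so it is
  -- reduced.
  have hpr : RAAG.length (RAAG.eval Γ p) = p.length := by
    refine le_antisymm (RAAG.length_eval_le p) ?_
    rw [hpl, hl]
    exact hcr _ (isConj_iff.2 ⟨(RAAG.eval Γ a)⁻¹, by rw [inv_inv, mul_assoc, hga]; group⟩)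
  have hla := RAAG.length_eval_le (Γ := Γ) a
  have hlb := RAAG.length_eval_le (Γ := Γ) b
  have hpne : p ≠ [] := by
    rintro rfl
    rw [List.length_nil] at hpl
    rw [List.eq_nil_of_length_eq_zero hpl.symm] at hmem
    simp at hmem
  refine ⟨_, _, _, k, RAAG.isConical_of_low_eq_nil hp hpr hpne, hg, hgb, hk, ⟨by simp [hgk], ?_⟩,
    fun n hn => ?_⟩
  · have h1 := RAAG.length_pow hcr k
    have h2 := RAAG.length_mul_le (RAAG.eval Γ a) (RAAG.eval Γ b)
    rw [← hgk, h1] at h2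
    rw [← hl] at h1 h2
    simp only [List.map_cons, List.map_nil, List.sum_cons, List.sum_nil]
    omega
  · have hpos : 0 < Fintype.card V := Fintype.card_pos_iff.2 ⟨v₀⟩
    obtain ⟨m, rfl⟩ := Nat.exists_eq_add_of_le (show k ≤ n by omega)
    rw [Nat.add_sub_cancel_left]
    have heq : RAAG.eval Γ w ^ (k + m)
        = RAAG.eval Γ a * (RAAG.eval Γ p ^ m * RAAG.eval Γ b) := by
      rw [add_comm, pow_add, hgk, hg, conj_pow]; group
    -- The chain (k+m)|g| ≤ |a| + |p^m| + |b| ≤ k|g| + m|g| forces equality throughout.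
    have h1 := RAAG.length_pow hcr (k + m)
    have h2 := RAAG.length_mul_le (RAAG.eval Γ a) (RAAG.eval Γ p ^ m * RAAG.eval Γ b)
    have h3 := RAAG.length_mul_le (RAAG.eval Γ p ^ m) (RAAG.eval Γ b)
    have h4 := RAAG.length_pow_le (RAAG.eval Γ p) m
    rw [← heq, h1] at h2
    rw [hpr, hpl] at h4
    rw [← hl, add_mul] at h1 h2
    refine ⟨⟨by simpa using heq, ?_⟩, ⟨by simpa [mul_assoc] using heq, ?_⟩⟩
    · simp only [List.map_cons, List.map_nil, List.sum_cons, List.sum_nil]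
      omega
    · simp only [List.map_append, List.map_cons, List.map_nil, List.map_replicate,
        List.sum_append, List.sum_cons, List.sum_nil, List.sum_replicate, smul_eq_mul, hpr, hpl]
      omega
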